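/- For an integer $n\ge 1$ let $\varrho(n)$ be the number of integers $a$ with $1\le a\le n$ that are regular (mod $n$), i.e. for which there is an integer $t$ with $a^2t\equiv a \pmod n$. There are real constants $D$ and $E$ such that, as $x\to\infty$ through the real numbers, $$\sum_{1\le n\le x}\frac1{\varrho(n)}=D\log x+E+O\left(\frac{\log^9 x}{x}\right),$$ where $$D=\frac{\zeta(2)\zeta(3)}{\zeta(6)}\prod_p\left(1-\frac{p(p-1)}{p^2-p+1}\sum_{\nu=1}^{\infty}\frac1{p^{\nu}\left(p^{\nu}-p^{\nu-1}+1\right)}\right),$$ the product running over all primes $p$, with the inner series and the infinite product convergent. Here $\zeta$ is the Riemann zeta function. -/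

import Mathlib

open Filter Asymptotics

/-- The integer `a` is regular (mod `n`): there is an integer `x` with `a² x ≡ a (mod n)`. -/
def IsRegularMod (n : ℕ) (a : ℤ) : Prop :=
  ∃ x : ℤ, a ^ 2 * x ≡ a [ZMOD (n : ℤ)]

open Classical in
/-- `ϱ(n)`: the number of integers `1 ≤ a ≤ n` that are regular (mod `n`). -/
noncomputable def regCount (n : ℕ) : ℕ :=
  ((Finset.Icc 1 n).filter (fun a : ℕ => IsRegularMod n (a : ℤ))).card

/-- The term of index `ν = k + 1 ≥ 1` of the inner series,
`1 / (p ^ ν (p ^ ν - p ^ (ν - 1) + 1))`. -/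
noncomputable def innerTerm (p : ℕ) (k : ℕ) : ℝ :=
  1 / ((p : ℝ) ^ (k + 1) * ((p : ℝ) ^ (k + 1) - (p : ℝ) ^ k + 1))

/-- The factor of the Euler product at `p`. -/
noncomputable def eulerFactor (p : ℕ) : ℝ :=
  1 - (p : ℝ) * ((p : ℝ) - 1) / ((p : ℝ) ^ 2 - (p : ℝ) + 1) * ∑' k : ℕ, innerTerm p k

/-! Write `n / ϱ(n) = ∑_{d ∣ n} g(d)` with `g = regCoeff`. By the Chinese remainder theorem and
`ϱ(p^k) = φ(p^k) + 1`, `g` is multiplicative; it is nonnegative, and `g(p) = 0` because `ϱ(p) = p`.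
Hence `∑_{n ≤ x} 1 / ϱ(n) = ∑_d (g(d) / d) H(x / d)`, where `H(y)` is the harmonic sum up to `y`,
equal to `log y + γ` plus an error. That error is at most `3 y^(ε - 1)` for every `y > 0`
(`abs_harmonicError_le`), so the total error is at most `3 x^(ε - 1) ∑ g(d) d^(-ε)`. Factor by
factor this series is dominated by `ζ(1 + ε) ≤ 1 + 1/ε` (`sum_range_regCoeff_mul_le`). Taking `ε = 1
/ log x` gives `O(log x / x)`, stronger than required. The leading constant `∑ g(d) / d` is then
expanded as an Euler product (`hasProd_eulerFactor`). -/

/-! ### Counting regular residues -/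

/-- An element `a` of a commutative ring is regular (in the sense of von Neumann) if
`a² x = a` for some `x`. -/
def IsVNRegular {R : Type*} [CommRing R] (a : R) : Prop :=
  ∃ x : R, a ^ 2 * x = a

lemma isRegularMod_iff (n : ℕ) (a : ℤ) : IsRegularMod n a ↔ IsVNRegular (a : ZMod n) := by
  constructor
  · rintro ⟨x, hx⟩
    refine ⟨(x : ZMod n), ?_⟩
    have := (ZMod.intCast_eq_intCast_iff _ _ n).2 hx
    exact_mod_cast this
  · rintro ⟨x, hx⟩
    obtain ⟨y, rfl⟩ := ZMod.intCast_surjective x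
    refine ⟨y, (ZMod.intCast_eq_intCast_iff _ _ n).1 ?_⟩
    exact_mod_cast hx

lemma regCount_eq_card {n : ℕ} (hn : n ≠ 0) :
    regCount n = Nat.card {a : ZMod n // IsVNRegular a} := by
  have : NeZero n := ⟨hn⟩
  classical
  rw [regCount, Nat.card_eq_fintype_card, Fintype.card_subtype]
  refine Finset.card_bij (fun a _ => (a : ZMod n)) ?_ ?_ ?_
  · intro a ha
    simpa [isRegularMod_iff] using (Finset.mem_filter.1 ha).2
  · intro a ha b hb hab
    have ha' := Finset.mem_Icc.1 (Finset.mem_filter.1 ha).1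
    have hb' := Finset.mem_Icc.1 (Finset.mem_filter.1 hb).1
    have h := (ZMod.intCast_eq_intCast_iff_dvd_sub a b n).1 (by exact_mod_cast hab)
    have h0 := Int.eq_zero_of_abs_lt_dvd h (by rw [abs_lt]; omega)
    omega
  · intro b hb
    have hb' := (Finset.mem_filter.1 hb).2
    rcases eq_or_ne b 0 with rfl | h0
    -- The representatives run over `1, …, n`, so the zero class is represented by `n`.
    · refine ⟨n, Finset.mem_filter.2 ⟨Finset.mem_Icc.2 ⟨by omega, le_rfl⟩, ?_⟩, by simp⟩
      simpa [isRegularMod_iff] using hb'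
    · refine ⟨b.val, Finset.mem_filter.2 ⟨Finset.mem_Icc.2 ⟨?_, (ZMod.val_lt b).le⟩, ?_⟩, by simp⟩
      · exact Nat.pos_of_ne_zero (by simpa [ZMod.val_eq_zero] using h0)
      · simpa [isRegularMod_iff] using hb'

lemma IsVNRegular.map_ringEquiv {R S : Type*} [CommRing R] [CommRing S] (e : R ≃+* S) (a : R) :
    IsVNRegular (e a) ↔ IsVNRegular a := by
  constructor
  · rintro ⟨x, hx⟩
    exact ⟨e.symm x, e.injective (by simpa using hx)⟩
  · rintro ⟨x, hx⟩
    exact ⟨e x, by rw [← map_pow, ← map_mul, hx]⟩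

lemma isVNRegular_prod {R S : Type*} [CommRing R] [CommRing S] (a : R × S) :
    IsVNRegular a ↔ IsVNRegular a.1 ∧ IsVNRegular a.2 := by
  constructor
  · rintro ⟨x, hx⟩
    exact ⟨⟨x.1, congrArg Prod.fst hx⟩, ⟨x.2, congrArg Prod.snd hx⟩⟩
  · rintro ⟨⟨x, hx⟩, ⟨y, hy⟩⟩
    exact ⟨(x, y), Prod.ext hx hy⟩

lemma regCount_mul {m n : ℕ} (h : m.Coprime n) : regCount (m * n) = regCount m * regCount n := by
  rcases eq_or_ne m 0 with rfl | hm
  · simp [regCount]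
  rcases eq_or_ne n 0 with rfl | hn
  · simp [regCount]
  rw [regCount_eq_card (mul_ne_zero hm hn), regCount_eq_card hm, regCount_eq_card hn,
    ← Nat.card_prod]
  refine Nat.card_congr ((((ZMod.chineseRemainder h).toEquiv.subtypeEquiv fun a => ?_).trans
    (Equiv.subtypeProdEquivProd (p := IsVNRegular) (q := IsVNRegular))))
  rw [← isVNRegular_prod, ← IsVNRegular.map_ringEquiv (ZMod.chineseRemainder h)]
  rfl

/-- Regularity says `a (a x - 1) = 0`. If `p ∣ a`, then `p ∤ a x - 1`, so the second factor is a
unit and `a = 0`. -/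
lemma isVNRegular_zmod_prime_pow {p k : ℕ} (hp : p.Prime) (hk : k ≠ 0) (a : ZMod (p ^ k)) :
    IsVNRegular a ↔ IsUnit a ∨ a = 0 := by
  have : NeZero (p ^ k) := ⟨pow_ne_zero _ hp.ne_zero⟩
  have unit_iff (b : ZMod (p ^ k)) : ¬ IsUnit b ↔ (p : ZMod (p ^ k)) ∣ b := by
    obtain ⟨c, rfl⟩ := ZMod.natCast_zmod_surjective b
    rw [ZMod.isUnit_iff_coprime, Nat.coprime_pow_right_iff (Nat.pos_of_ne_zero hk),
      Nat.coprime_comm, hp.coprime_iff_not_dvd, not_not]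
    constructor
    · exact fun h => by exact_mod_cast Nat.cast_dvd_cast h
    · rintro ⟨d, hd⟩
      obtain ⟨e, rfl⟩ := ZMod.natCast_zmod_surjective d
      have h1 : ((c : ℕ) : ZMod (p ^ k)) = ((p * e : ℕ) : ZMod (p ^ k)) := by exact_mod_cast hd
      have h2 := ((ZMod.natCast_eq_natCast_iff _ _ _).1 h1).of_dvd (dvd_pow_self p hk)
      exact (Nat.modEq_zero_iff_dvd).1 (h2.trans ((Nat.modEq_zero_iff_dvd).2 (dvd_mul_right p e)))
  constructor
  · rintro ⟨x, hx⟩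
    rw [or_iff_not_imp_left]
    intro ha
    have hu : IsUnit (a * x - 1) := by
      by_contra hc
      have h1 := (unit_iff _).1 hc
      have h2 : (p : ZMod (p ^ k)) ∣ 1 := by
        have h3 := dvd_sub (((unit_iff _).1 ha).mul_right x) h1
        simpa using h3
      exact (unit_iff 1).2 h2 isUnit_one
    refine hu.mul_left_eq_zero.1 ?_
    linear_combination hx
  · rintro (h | rfl)
    · obtain ⟨u, rfl⟩ := h
      exact ⟨(u⁻¹ : (ZMod (p ^ k))ˣ), by rw [pow_two, mul_assoc, Units.mul_inv, mul_one]⟩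
    · exact ⟨0, by simp⟩

lemma regCount_prime_pow {p k : ℕ} (hp : p.Prime) (hk : k ≠ 0) :
    regCount (p ^ k) = (p ^ k).totient + 1 := by
  have : NeZero (p ^ k) := ⟨pow_ne_zero _ hp.ne_zero⟩
  have : Fact (1 < p ^ k) := ⟨Nat.one_lt_pow hk hp.one_lt⟩
  classical
  rw [regCount_eq_card (pow_ne_zero _ hp.ne_zero),
    Nat.card_congr (Equiv.subtypeEquivRight (isVNRegular_zmod_prime_pow hp hk)),
    Nat.card_eq_fintype_card, Fintype.card_subtype_or_disjoint]
  · rw [Fintype.card_subtype_eq, ← ZMod.card_units_eq_totient]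
    congr 1
    exact Fintype.card_congr (Equiv.ofBijective (fun u : (ZMod (p ^ k))ˣ =>
      (⟨u, u.isUnit⟩ : {a : ZMod (p ^ k) // IsUnit a}))
      ⟨fun u v h => Units.ext (congrArg Subtype.val h), fun a => ⟨a.2.unit, rfl⟩⟩).symm
  · rw [Pi.disjoint_iff]
    intro a
    rw [Prop.disjoint_iff]
    rintro ⟨h, rfl⟩
    exact not_isUnit_zero h

lemma regCount_one : regCount 1 = 1 := by
  classical
  rw [regCount, Finset.filter_true_of_mem]
  · simp
  · intro a _
    exact ⟨0, by simpa using Int.modEq_one⟩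

/-! ### The Möbius transform of `n / ϱ(n)` -/

/-- The arithmetic function `n ↦ n / ϱ(n)`. -/
noncomputable def idDivReg : ArithmeticFunction ℝ :=
  ⟨fun n => (n : ℝ) / regCount n, by simp⟩

lemma idDivReg_apply (n : ℕ) : idDivReg n = (n : ℝ) / regCount n := rfl

lemma isMultiplicative_idDivReg : idDivReg.IsMultiplicative := by
  refine ⟨by simp [idDivReg_apply, regCount_one], fun h => ?_⟩
  rw [idDivReg_apply, idDivReg_apply, idDivReg_apply, regCount_mul h]
  push_cast
  rw [mul_div_mul_comm]

/-- The Möbius transform of `n ↦ n / ϱ(n)`. -/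
noncomputable def regCoeff : ArithmeticFunction ℝ :=
  (ArithmeticFunction.moebius : ArithmeticFunction ℝ) * idDivReg

lemma isMultiplicative_regCoeff : regCoeff.IsMultiplicative :=
  ArithmeticFunction.isMultiplicative_moebius.intCast.mul isMultiplicative_idDivReg

lemma zeta_mul_regCoeff :
    (ArithmeticFunction.zeta : ArithmeticFunction ℝ) * regCoeff = idDivReg := by
  rw [regCoeff, ← mul_assoc, ArithmeticFunction.coe_zeta_mul_coe_moebius, one_mul]

lemma sum_regCoeff_prime_pow {p : ℕ} (hp : p.Prime) (k : ℕ) :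
    ∑ j ∈ Finset.range (k + 1), regCoeff (p ^ j) = idDivReg (p ^ k) := by
  rw [← zeta_mul_regCoeff, ArithmeticFunction.coe_zeta_mul_apply, Nat.sum_divisors_prime_pow hp]

lemma regCoeff_prime_pow_succ {p : ℕ} (hp : p.Prime) (k : ℕ) :
    regCoeff (p ^ (k + 1)) = idDivReg (p ^ (k + 1)) - idDivReg (p ^ k) := by
  rw [← sum_regCoeff_prime_pow hp, ← sum_regCoeff_prime_pow hp, Finset.sum_range_succ _ (k + 1)]
  ring

lemma regCount_prime_pow_succ {p : ℕ} (hp : p.Prime) (k : ℕ) :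
    (regCount (p ^ (k + 1)) : ℝ) = (p : ℝ) ^ (k + 1) - (p : ℝ) ^ k + 1 := by
  rw [regCount_prime_pow hp k.succ_ne_zero, Nat.totient_prime_pow_succ hp]
  push_cast [Nat.cast_sub hp.one_le]
  ring

lemma idDivReg_prime_pow_succ {p : ℕ} (hp : p.Prime) (k : ℕ) :
    idDivReg (p ^ (k + 1)) = (p : ℝ) ^ (k + 1) / ((p : ℝ) ^ (k + 1) - (p : ℝ) ^ k + 1) := by
  rw [idDivReg_apply, regCount_prime_pow_succ hp]
  push_cast
  rfl

lemma idDivReg_prime_pow_le {p : ℕ} (hp : p.Prime) (k : ℕ) :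
    idDivReg (p ^ k) ≤ 1 + 1 / ((p : ℝ) - 1) := by
  have h2 : (2 : ℝ) ≤ p := by exact_mod_cast hp.two_le
  have h1 : (0 : ℝ) < p - 1 := by linarith
  rcases k with - | k
  · simp [isMultiplicative_idDivReg.map_one, h1.le]
  · have hpk : (0 : ℝ) < (p : ℝ) ^ k := by positivity
    have hd : 0 < (p : ℝ) ^ (k + 1) - (p : ℝ) ^ k + 1 := by
      rw [pow_succ]; nlinarith
    rw [idDivReg_prime_pow_succ hp, div_le_iff₀ hd, one_add_div h1.ne', div_mul_eq_mul_div,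
      le_div_iff₀ h1, pow_succ]
    nlinarith

/-- The values `p^k / ϱ(p^k)` are nondecreasing in `k`, and `regCoeff` takes their successive
differences. -/
lemma regCoeff_prime_pow_nonneg {p : ℕ} (hp : p.Prime) (k : ℕ) : 0 ≤ regCoeff (p ^ k) := by
  have h2 : (2 : ℝ) ≤ p := by exact_mod_cast hp.two_le
  rcases k with - | - | k
  · simp [isMultiplicative_regCoeff.map_one]
  · rw [regCoeff_prime_pow_succ hp, idDivReg_prime_pow_succ hp, pow_zero p,
      isMultiplicative_idDivReg.map_one]
    simp [hp.ne_zero]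
  · rw [regCoeff_prime_pow_succ hp, idDivReg_prime_pow_succ hp, idDivReg_prime_pow_succ hp,
      sub_nonneg]
    have hpk : (0 : ℝ) < (p : ℝ) ^ k := by positivity
    rw [div_le_div_iff₀ (by rw [pow_succ]; nlinarith)
      (by rw [pow_succ, pow_succ]; nlinarith [mul_pos hpk (by linarith : (0:ℝ) < p)])]
    simp only [pow_succ]
    nlinarith [mul_pos hpk (by linarith : (0:ℝ) < p)]

lemma regCoeff_nonneg (n : ℕ) : 0 ≤ regCoeff n := by
  rcases eq_or_ne n 0 with rfl | hn
  · simp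
  rw [isMultiplicative_regCoeff.multiplicative_factorization _ hn]
  exact Finset.prod_nonneg fun p hp =>
    regCoeff_prime_pow_nonneg (Nat.prime_of_mem_primeFactors hp) _

/-- Every residue mod `p` is regular. This vanishing supplies the factor `u^(-2)` in the local
comparison with `ζ (1 + s)`. -/
lemma regCoeff_prime {p : ℕ} (hp : p.Prime) : regCoeff p = 0 := by
  have := regCoeff_prime_pow_succ hp 0
  rw [idDivReg_prime_pow_succ hp, pow_zero p, isMultiplicative_idDivReg.map_one] at this
  simpa [hp.ne_zero] using this

/-! ### Comparison of Dirichlet series with `ζ (1 + s)` -/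

/-- The Euler factor at `p` of `∑ regCoeff n / n ^ s`, where `u = p ^ s`, is at most that of
`ζ (1 + s)`. -/
lemma sum_regCoeff_prime_pow_div_le {p : ℕ} (hp : p.Prime) {u : ℝ} (hu : 1 ≤ u) (K : ℕ) :
    ∑ k ∈ Finset.range K, regCoeff (p ^ k) * (u ^ k)⁻¹ ≤ (1 - ((p : ℝ) * u)⁻¹)⁻¹ := by
  have h2 : (2 : ℝ) ≤ p := by exact_mod_cast hp.two_le
  have h1 : (0 : ℝ) < p - 1 := by linarith
  have hu0 : 0 < u := by linarith
  have key (K : ℕ) : ∑ k ∈ Finset.range (K + 2), regCoeff (p ^ k) * (u ^ k)⁻¹ ≤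
      1 + (u ^ 2)⁻¹ * (1 / ((p : ℝ) - 1)) := by
    have hs := (sum_regCoeff_prime_pow hp (K + 1)).trans_le (idDivReg_prime_pow_le hp (K + 1))
    rw [Finset.sum_range_succ', Finset.sum_range_succ'] at hs ⊢
    simp only [zero_add, pow_zero, pow_one, regCoeff_prime hp, isMultiplicative_regCoeff.map_one,
      zero_mul, add_zero, inv_one, mul_one] at hs ⊢
    rw [add_comm]
    gcongr
    calc _ ≤ ∑ k ∈ Finset.range K, (u ^ 2)⁻¹ * regCoeff (p ^ (k + 1 + 1)) := by
          refine Finset.sum_le_sum fun k _ => ?_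
          rw [mul_comm]
          refine mul_le_mul_of_nonneg_right ?_ (regCoeff_nonneg _)
          exact inv_anti₀ (by positivity) (pow_le_pow_right₀ hu (by omega))
      _ ≤ _ := by
          rw [← Finset.mul_sum]
          refine mul_le_mul_of_nonneg_left ?_ (by positivity)
          linarith
  calc _ ≤ ∑ k ∈ Finset.range (K + 2), regCoeff (p ^ k) * (u ^ k)⁻¹ :=
        Finset.sum_le_sum_of_subset_of_nonneg (Finset.range_mono (by omega))
          fun k _ _ => mul_nonneg (regCoeff_nonneg _) (by positivity)
    _ ≤ _ := key K
    _ ≤ _ := by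
      have hpu : 1 < (p : ℝ) * u := by nlinarith
      have hpu' : 0 < (p : ℝ) * u - 1 := by linarith
      have e : (1 - ((p : ℝ) * u)⁻¹)⁻¹ = 1 + 1 / ((p : ℝ) * u - 1) := by
        have : (p : ℝ) * u ≠ 0 := by positivity
        field_simp
        ring
      rw [e, ← one_div, div_mul_div_comm, one_mul]
      gcongr
      -- The claim `p u - 1 ≤ u² (p - 1)` is `(u - 1) ((p - 1) u - 1) ≥ 0`.
      nlinarith [mul_nonneg (sub_nonneg.2 hu) (by nlinarith : 0 ≤ ((p : ℝ) - 1) * u - 1)]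

lemma tsum_inv_rpow_one_add_le {s : ℝ} (hs : 0 < s) :
    ∑' n : ℕ, ((n : ℝ) ^ (1 + s))⁻¹ ≤ 1 + 1 / s := by
  have h := ZetaAsymptotics.zeta_limit_aux1 (s := 1 + s) (by linarith)
  have hT : 0 ≤ ZetaAsymptotics.termTSum (1 + s) :=
    tsum_nonneg fun n => ZetaAsymptotics.term_nonneg _ _
  rw [(Real.summable_nat_rpow_inv.2 (by linarith : 1 < 1 + s)).tsum_eq_zero_add]
  have h0 : (((0 : ℕ) : ℝ) ^ (1 + s))⁻¹ = 0 := by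
    rw [Nat.cast_zero, Real.zero_rpow (by linarith), inv_zero]
  have h1 : ∑' n : ℕ, (((n + 1 : ℕ) : ℝ) ^ (1 + s))⁻¹ = ∑' n : ℕ, 1 / (n + 1 : ℝ) ^ (1 + s) := by
    simp
  rw [h0, zero_add, h1]
  rw [add_sub_cancel_left] at h
  nlinarith

/-- The completely multiplicative function `n ↦ n ^ (-s)`. -/
noncomputable def invRpowHom (s : ℝ) : ℕ →* ℝ where
  toFun n := ((n : ℝ) ^ s)⁻¹
  map_one' := by simp
  map_mul' m n := by
    rw [Nat.cast_mul, Real.mul_rpow m.cast_nonneg n.cast_nonneg, mul_inv]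

lemma invRpowHom_apply (s : ℝ) (n : ℕ) : invRpowHom s n = ((n : ℝ) ^ s)⁻¹ := rfl

/-- Integers in `[1, N)` are `N`-smooth, so a finite Euler product bounds the partial sum by
nonnegativity. Convergence of the full series is thus a consequence, not an assumption. -/
lemma sum_range_regCoeff_mul_le {s : ℝ} (hs : 0 < s) (N : ℕ) :
    ∑ n ∈ Finset.range N, regCoeff n * invRpowHom s n ≤ 1 + 1 / s := by
  set f : ℕ → ℝ := fun n => regCoeff n * invRpowHom s n with hf
  have hinv (n : ℕ) : 0 ≤ invRpowHom s n := inv_nonneg.2 (Real.rpow_nonneg n.cast_nonneg s)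
  have hf0 (n : ℕ) : 0 ≤ f n := mul_nonneg (regCoeff_nonneg n) (hinv n)
  have hu {p : ℕ} (hp : p.Prime) : 1 ≤ (p : ℝ) ^ s :=
    Real.one_le_rpow (by exact_mod_cast hp.one_le) hs.le
  have hpow (p k : ℕ) : f (p ^ k) = regCoeff (p ^ k) * (((p : ℝ) ^ s) ^ k)⁻¹ := by
    rw [hf]
    simp only [map_pow, invRpowHom_apply, inv_pow]
  have hpart {p : ℕ} (hp : p.Prime) (K : ℕ) :
      ∑ k ∈ Finset.range K, f (p ^ k) ≤ (1 - invRpowHom (1 + s) p)⁻¹ := by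
    have hp0 : (0 : ℝ) < p := by exact_mod_cast hp.pos
    simp only [hpow, invRpowHom_apply, Real.rpow_add hp0, Real.rpow_one]
    exact sum_regCoeff_prime_pow_div_le hp (hu hp) K
  have hsum {p : ℕ} (hp : p.Prime) : Summable fun k => f (p ^ k) :=
    summable_of_sum_range_le (fun _ => hf0 _) (hpart hp)
  have hE := EulerProduct.summable_and_hasSum_smoothNumbers_prod_primesBelow_tsum (f := f)
    (by simp [hf, isMultiplicative_regCoeff.map_one])
    (fun {m n} h => by
      simp only [hf]
      rw [isMultiplicative_regCoeff.map_mul_of_coprime h, map_mul]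
      ring) (fun {p} hp => by simpa [abs_of_nonneg (hf0 _)] using hsum hp) N
  have hz : Summable (invRpowHom (1 + s)) :=
    Real.summable_nat_rpow_inv.2 (by linarith : 1 < 1 + s)
  have hZ := EulerProduct.prod_primesBelow_geometric_eq_tsum_smoothNumbers hz N
  calc ∑ n ∈ Finset.range N, f n
      = ∑ n ∈ (Finset.range N).filter (· ∈ N.smoothNumbers), f n := by
        refine (Finset.sum_filter_of_ne fun n hn h0 => ?_).symm
        refine Nat.mem_smoothNumbers_of_lt (Nat.pos_of_ne_zero ?_) (Finset.mem_range.1 hn)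
        rintro rfl
        simp [hf] at h0
    _ = ∑ m ∈ (Finset.range N).subtype (· ∈ N.smoothNumbers), f m :=
        (Finset.sum_subtype_eq_sum_filter _).symm
    _ ≤ ∏ p ∈ N.primesBelow, ∑' k : ℕ, f (p ^ k) :=
        sum_le_hasSum _ (fun _ _ => hf0 _) hE.2
    _ ≤ ∏ p ∈ N.primesBelow, (1 - invRpowHom (1 + s) p)⁻¹ :=
        Finset.prod_le_prod (fun p _ => tsum_nonneg fun _ => hf0 _) fun p hp =>
          Real.tsum_le_of_sum_range_le (fun _ => hf0 _) (hpart (Nat.prime_of_mem_primesBelow hp))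
    _ = ∑' m : N.smoothNumbers, invRpowHom (1 + s) m := hZ
    _ ≤ ∑' n : ℕ, invRpowHom (1 + s) n :=
        hz.tsum_subtype_le _ _ fun n => inv_nonneg.2 (Real.rpow_nonneg n.cast_nonneg _)
    _ ≤ 1 + 1 / s := tsum_inv_rpow_one_add_le hs

lemma regCoeff_mul_rpow_nonneg (s : ℝ) (n : ℕ) : 0 ≤ regCoeff n * ((n : ℝ) ^ s)⁻¹ :=
  mul_nonneg (regCoeff_nonneg n) (inv_nonneg.2 (Real.rpow_nonneg n.cast_nonneg s))

lemma summable_regCoeff_mul_rpow {s : ℝ} (hs : 0 < s) :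
    Summable fun n : ℕ => regCoeff n * ((n : ℝ) ^ s)⁻¹ :=
  summable_of_sum_range_le (regCoeff_mul_rpow_nonneg s) (sum_range_regCoeff_mul_le hs)

lemma tsum_regCoeff_mul_rpow_le {s : ℝ} (hs : 0 < s) :
    ∑' n : ℕ, regCoeff n * ((n : ℝ) ^ s)⁻¹ ≤ 1 + 1 / s :=
  Real.tsum_le_of_sum_range_le (regCoeff_mul_rpow_nonneg s) (sum_range_regCoeff_mul_le hs)

lemma summable_regCoeff_div : Summable fun n : ℕ => regCoeff n / n := by
  simpa [div_eq_mul_inv] using summable_regCoeff_mul_rpow one_pos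

/-! ### Harmonic sums -/

/-- The error term in `∑_{n ≤ y} 1 / n = log y + γ + harmonicError y`. -/
noncomputable def harmonicError (y : ℝ) : ℝ :=
  ∑ n ∈ Finset.Ioc 0 ⌊y⌋₊, (n : ℝ)⁻¹ - Real.log y - Real.eulerMascheroniConstant

lemma sum_Ioc_inv_eq_harmonic (n : ℕ) : ∑ k ∈ Finset.Ioc 0 n, (k : ℝ)⁻¹ = (harmonic n : ℝ) := by
  rw [harmonic_eq_sum_Icc]
  push_cast
  rfl

lemma abs_harmonicError_le_of_one_le {y : ℝ} (hy : 1 ≤ y) : |harmonicError y| ≤ 2 / y := by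
  have hn : 1 ≤ ⌊y⌋₊ := Nat.one_le_floor_iff y |>.2 hy
  have hle : (⌊y⌋₊ : ℝ) ≤ y := Nat.floor_le (by linarith)
  have hlt : y < ⌊y⌋₊ + 1 := Nat.lt_floor_add_one y
  rw [harmonicError, sum_Ioc_inv_eq_harmonic]
  generalize ⌊y⌋₊ = n at *
  have hn' : (1 : ℝ) ≤ n := by exact_mod_cast hn
  have h1 := Real.eulerMascheroniSeq_lt_eulerMascheroniConstant n
  have h2 := Real.eulerMascheroniConstant_lt_eulerMascheroniSeq' n
  rw [Real.eulerMascheroniSeq] at h1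
  rw [Real.eulerMascheroniSeq', if_neg (by omega)] at h2
  have h3 : Real.log n ≤ Real.log y := Real.log_le_log (by linarith) hle
  have h4 : Real.log y ≤ Real.log (n + 1) := Real.log_le_log (by linarith) hlt.le
  have h5 : Real.log (n + 1) - Real.log n ≤ 1 / n := by
    rw [← Real.log_div (by linarith) (by linarith)]
    refine (Real.log_le_sub_one_of_pos (by positivity)).trans_eq ?_
    field_simp
    ring
  have h6 : 1 / (n : ℝ) ≤ 2 / y := by
    rw [div_le_div_iff₀ (by linarith) (by linarith)]
    linarith
  rw [abs_le]
  constructor <;> linarith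

/-- Including `y < 1`, where the sum is empty and the error is `-log y - γ`, allows summation over
all `d` with no separate tail estimate. -/
lemma abs_harmonicError_le {y ε : ℝ} (hy : 0 < y) (hε : 0 ≤ ε) (hε' : ε ≤ 1 / 2) :
    |harmonicError y| ≤ 3 * y ^ (ε - 1) := by
  rcases le_or_gt 1 y with h | h
  · refine (abs_harmonicError_le_of_one_le h).trans ?_
    have : y ^ (-1 : ℝ) ≤ y ^ (ε - 1) := Real.rpow_le_rpow_of_exponent_le h (by linarith)
    rw [Real.rpow_neg_one] at this
    have h0 : 0 < y⁻¹ := inv_pos.2 hy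
    rw [div_eq_mul_inv]
    linarith
  · have hfl : ⌊y⌋₊ = 0 := Nat.floor_eq_zero.2 h
    have h1 : y ^ (-(1 / 2) : ℝ) ≤ y ^ (ε - 1) :=
      Real.rpow_le_rpow_of_exponent_ge hy h.le (by linarith)
    have h2 : 1 ≤ y ^ (-(1 / 2) : ℝ) := Real.one_le_rpow_of_pos_of_le_one_of_nonpos hy h.le (by norm_num)
    have h3 := Real.log_le_rpow_div (x := y⁻¹) (by positivity) (by norm_num : (0 : ℝ) < 1 / 2)
    rw [Real.log_inv, Real.inv_rpow hy.le, ← Real.rpow_neg hy.le] at h3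
    have h4 := Real.one_half_lt_eulerMascheroniConstant
    have h5 := Real.eulerMascheroniConstant_lt_two_thirds
    have h6 := Real.log_neg hy h
    rw [harmonicError, hfl, Finset.Ioc_self, Finset.sum_empty, abs_le]
    constructor <;> linarith

/-! ### The asymptotic formula -/

/-- Dividing `n / ϱ(n) = (1 * g)(n)` by `n` exhibits `1 / ϱ` as the Dirichlet convolution of `g(n) /
n` and `1 / n`. -/
lemma sum_inv_regCount_eq (N : ℕ) :
    ∑ n ∈ Finset.Icc 1 N, 1 / (regCount n : ℝ) =
      ∑ d ∈ Finset.Ioc 0 N, regCoeff d / d * ∑ n ∈ Finset.Ioc 0 (N / d), (n : ℝ)⁻¹ := by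
  let G : ArithmeticFunction ℝ := ⟨fun n => regCoeff n / n, by simp⟩
  let K : ArithmeticFunction ℝ := ⟨fun n => (n : ℝ)⁻¹, by simp⟩
  have hG (n : ℕ) : G n = regCoeff n / n := rfl
  have hK (n : ℕ) : K n = (n : ℝ)⁻¹ := rfl
  have h := ArithmeticFunction.sum_Ioc_mul_eq_sum_sum G K N
  simp only [hG, hK] at h
  rw [← h]
  refine Finset.sum_congr rfl fun n hn => ?_
  have hn0 : n ≠ 0 := by have := (Finset.mem_Icc.1 hn).1; omega
  have hn1 : (n : ℝ) ≠ 0 := by exact_mod_cast hn0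
  have h1 : 1 / (regCount n : ℝ) = idDivReg n / n := by
    rw [idDivReg_apply]
    field_simp
  rw [h1, ← zeta_mul_regCoeff, ArithmeticFunction.coe_zeta_mul_apply, ArithmeticFunction.mul_apply,
    ← Nat.sum_div_divisors, Finset.sum_div, Nat.sum_divisorsAntidiagonal' (fun a b => G a * K b)]
  refine Finset.sum_congr rfl fun d hd => ?_
  rw [hG, hK]
  have := Nat.div_mul_cancel (Nat.dvd_of_mem_divisors hd)
  rw [div_mul_eq_mul_div, ← div_eq_mul_inv, div_div]
  congr 1
  rw [mul_comm]
  exact_mod_cast this.symm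

lemma summable_regCoeff_div_mul_log :
    Summable fun n : ℕ => regCoeff n / n * Real.log n := by
  refine Summable.of_nonneg_of_le (fun n => ?_) (fun n => ?_)
    ((summable_regCoeff_mul_rpow (s := 1 / 2) (by norm_num)).mul_right 2)
  · exact mul_nonneg (div_nonneg (regCoeff_nonneg n) n.cast_nonneg) (Real.log_natCast_nonneg n)
  · rcases eq_or_ne n 0 with rfl | hn
    · simp
    have hn0 : (0 : ℝ) < n := by exact_mod_cast Nat.pos_of_ne_zero hn
    have h := Real.log_le_rpow_div (x := n) hn0.le (by norm_num : (0 : ℝ) < 1 / 2)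
    rw [← Real.sqrt_eq_rpow] at h ⊢
    have hs : 0 < √(n : ℝ) := Real.sqrt_pos.2 hn0
    calc regCoeff n / n * Real.log n ≤ regCoeff n / n * (√n / (1 / 2)) :=
          mul_le_mul_of_nonneg_left h (div_nonneg (regCoeff_nonneg n) n.cast_nonneg)
      _ = regCoeff n * (√(n : ℝ))⁻¹ * 2 := by
          nth_rw 1 [← Real.mul_self_sqrt hn0.le]
          field_simp

/-- The constant term of the asymptotic expansion of `∑_{n ≤ x} 1 / ϱ(n)`. -/
noncomputable def regConst : ℝ :=
  Real.eulerMascheroniConstant * ∑' n : ℕ, regCoeff n / n -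
    ∑' n : ℕ, regCoeff n / n * Real.log n

lemma hasSum_error {x : ℝ} (hx : 0 < x) :
    HasSum (fun d : ℕ => regCoeff d / d * harmonicError (x / d))
      (∑ n ∈ Finset.Icc 1 ⌊x⌋₊, 1 / (regCount n : ℝ) -
        ((∑' n : ℕ, regCoeff n / n) * Real.log x + regConst)) := by
  have h1 : HasSum (fun d : ℕ => regCoeff d / d * ∑ n ∈ Finset.Ioc 0 ⌊x / d⌋₊, (n : ℝ)⁻¹)
      (∑ n ∈ Finset.Icc 1 ⌊x⌋₊, 1 / (regCount n : ℝ)) := by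
    rw [sum_inv_regCount_eq]
    simp only [Nat.floor_div_natCast]
    refine hasSum_sum_of_ne_finset_zero fun d hd => ?_
    rcases eq_or_ne d 0 with rfl | hd0
    · simp
    · rw [Nat.div_eq_of_lt (by simp only [Finset.mem_Ioc] at hd; omega)]
      simp
  have hD := summable_regCoeff_div.hasSum
  have hL := summable_regCoeff_div_mul_log.hasSum
  have h2 := h1.sub ((hD.mul_right (Real.log x)).add
    ((hD.mul_left Real.eulerMascheroniConstant).sub hL))
  refine h2.congr_fun ?_
  intro d
  rcases eq_or_ne d 0 with rfl | hd0
  · simp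
  · rw [harmonicError, Real.log_div hx.ne' (by exact_mod_cast hd0)]
    ring

lemma abs_error_le {x ε : ℝ} (hx : 0 < x) (hε : 0 < ε) (hε' : ε ≤ 1 / 2) :
    |∑ n ∈ Finset.Icc 1 ⌊x⌋₊, 1 / (regCount n : ℝ) -
        ((∑' n : ℕ, regCoeff n / n) * Real.log x + regConst)| ≤
      3 * x ^ (ε - 1) * (1 + 1 / ε) := by
  have hb (d : ℕ) : ‖regCoeff d / d * harmonicError (x / d)‖ ≤
      3 * x ^ (ε - 1) * (regCoeff d * ((d : ℝ) ^ ε)⁻¹) := by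
    rcases eq_or_ne d 0 with rfl | hd0
    · simp
    have hd : (0 : ℝ) < d := by exact_mod_cast Nat.pos_of_ne_zero hd0
    have h := abs_harmonicError_le (div_pos hx hd) hε.le hε'
    rw [Real.norm_eq_abs, abs_mul, abs_of_nonneg (div_nonneg (regCoeff_nonneg d) hd.le)]
    refine (mul_le_mul_of_nonneg_left h (div_nonneg (regCoeff_nonneg d) hd.le)).trans_eq ?_
    rw [Real.div_rpow hx.le hd.le, Real.rpow_sub_one hd.ne']
    field_simp
  have hs := (summable_regCoeff_mul_rpow hε).mul_left (3 * x ^ (ε - 1))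
  rw [← (hasSum_error hx).tsum_eq, ← Real.norm_eq_abs]
  refine (tsum_of_norm_bounded hs.hasSum hb).trans ?_
  rw [tsum_mul_left]
  exact mul_le_mul_of_nonneg_left (tsum_regCoeff_mul_rpow_le hε) (by positivity)

/-- The summatory function of `1 / ϱ` is `D log x + E + O(log x / x)`. -/
lemma isBigO_sum_inv_regCount :
    (fun x : ℝ => (∑ n ∈ Finset.Icc 1 ⌊x⌋₊, 1 / (regCount n : ℝ)) -
        ((∑' n : ℕ, regCoeff n / n) * Real.log x + regConst))
      =O[atTop] (fun x : ℝ => Real.log x / x) := by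
  refine IsBigO.of_bound (6 * Real.exp 1) ?_
  filter_upwards [eventually_ge_atTop (Real.exp 2)] with x hx
  have hx0 : 0 < x := (Real.exp_pos 2).trans_le hx
  have hl : 2 ≤ Real.log x := (Real.le_log_iff_exp_le hx0).2 hx
  -- This choice makes `x^ε = e` and `1 / ε = log x`; `x ≥ e²` ensures `ε ≤ 1/2`.
  have h := abs_error_le (ε := (Real.log x)⁻¹) hx0 (by positivity)
    (by rw [one_div]; exact inv_anti₀ (by norm_num) hl)
  rw [Real.norm_eq_abs, Real.norm_of_nonneg (by positivity)]
  refine h.trans ?_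
  rw [Real.rpow_sub_one hx0.ne', Real.rpow_def_of_pos hx0, mul_inv_cancel₀ (by linarith),
    one_div, inv_inv]
  have : 0 < Real.exp 1 / x := by positivity
  calc _ = Real.exp 1 / x * (3 * (1 + Real.log x)) := by ring
    _ ≤ Real.exp 1 / x * (6 * Real.log x) :=
        mul_le_mul_of_nonneg_left (by linarith) this.le
    _ = _ := by ring

/-! ### The Euler product of the leading constant -/

lemma innerTerm_nonneg {p : ℕ} (hp : p.Prime) (k : ℕ) : 0 ≤ innerTerm p k := by
  rw [innerTerm, ← regCount_prime_pow_succ hp]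
  positivity

/-- With `ν = k + 1`, this rests on `ϱ(p^ν) - 1 = p^ν (p - 1) / p`; it is the source of the inner
series. -/
lemma one_div_regCount_prime_pow_succ {p : ℕ} (hp : p.Prime) (k : ℕ) :
    1 / (regCount (p ^ (k + 1)) : ℝ) =
      (p : ℝ) / ((p : ℝ) - 1) * ((p : ℝ)⁻¹ ^ (k + 1) - innerTerm p k) := by
  have h2 : (2 : ℝ) ≤ p := by exact_mod_cast hp.two_le
  have h1 : (0 : ℝ) < p - 1 := by linarith
  have hpk : (0 : ℝ) < (p : ℝ) ^ k := by positivity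
  have hd : 0 < (p : ℝ) ^ k * p - (p : ℝ) ^ k + 1 := by nlinarith
  have hp0 : (p : ℝ) ≠ 0 := by linarith
  rw [innerTerm, regCount_prime_pow_succ hp, inv_pow, pow_succ]
  field_simp
  ring

lemma summable_inv_pow_succ {p : ℕ} (hp : p.Prime) : Summable fun k : ℕ => (p : ℝ)⁻¹ ^ (k + 1) :=
  (summable_nat_add_iff 1).2 (summable_geometric_of_lt_one (by positivity)
    (inv_lt_one_of_one_lt₀ (by exact_mod_cast hp.one_lt)))

lemma summable_innerTerm {p : ℕ} (hp : p.Prime) : Summable (innerTerm p) := by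
  refine Summable.of_nonneg_of_le (innerTerm_nonneg hp) (fun k => ?_) (summable_inv_pow_succ hp)
  have h2 : (2 : ℝ) ≤ p := by exact_mod_cast hp.two_le
  have h := one_div_regCount_prime_pow_succ hp k
  have h1 : 0 ≤ (p : ℝ) / ((p : ℝ) - 1) * ((p : ℝ)⁻¹ ^ (k + 1) - innerTerm p k) := by
    rw [← h]; positivity
  have h3 : 0 < (p : ℝ) / ((p : ℝ) - 1) := div_pos (by linarith) (by linarith)
  linarith [nonneg_of_mul_nonneg_right h1 h3]

lemma tsum_regCoeff_prime_pow_div {p : ℕ} (hp : p.Prime) :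
    ∑' k : ℕ, regCoeff (p ^ k) / ((p ^ k : ℕ) : ℝ) =
      (1 - (p : ℝ)⁻¹ ^ 6) / ((1 - (p : ℝ)⁻¹ ^ 2) * (1 - (p : ℝ)⁻¹ ^ 3)) * eulerFactor p := by
  have h2 : (2 : ℝ) ≤ p := by exact_mod_cast hp.two_le
  have h1 : (0 : ℝ) < p - 1 := by linarith
  have hp0 : (p : ℝ) ≠ 0 := by linarith
  have hi := summable_innerTerm hp
  have hgs := summable_inv_pow_succ hp
  set a : ℕ → ℝ := fun k => 1 / (regCount (p ^ k) : ℝ) with ha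
  have ha0 : a 0 = 1 := by simp [ha, regCount_one]
  have ha_succ : (fun k => a (k + 1)) =
      fun k => (p : ℝ) / ((p : ℝ) - 1) * ((p : ℝ)⁻¹ ^ (k + 1) - innerTerm p k) :=
    funext fun k => one_div_regCount_prime_pow_succ hp k
  have hsa1 : Summable fun k => a (k + 1) := by
    rw [ha_succ]
    exact (hgs.sub hi).mul_left _
  have hsa : Summable a := (summable_nat_add_iff 1).1 hsa1
  have hF (k : ℕ) : idDivReg (p ^ k) = (p : ℝ) ^ k * a k := by
    rw [idDivReg_apply, ha]
    push_cast
    ring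
  -- Summed over `k`, this gives `∑ g(p^k) / p^k = (1 - 1/p) ∑ 1 / ϱ(p^k)`.
  have hg (k : ℕ) : regCoeff (p ^ (k + 1)) / ((p ^ (k + 1) : ℕ) : ℝ) =
      a (k + 1) - (p : ℝ)⁻¹ * a k := by
    rw [regCoeff_prime_pow_succ hp, hF, hF]
    push_cast
    rw [pow_succ]
    field_simp
  have hsg : Summable fun k : ℕ => regCoeff (p ^ k) / ((p ^ k : ℕ) : ℝ) := by
    refine (summable_nat_add_iff 1).1 ?_
    simp only [hg]
    exact hsa1.sub (hsa.mul_left _)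
  have hgeom : ∑' k : ℕ, (p : ℝ)⁻¹ ^ (k + 1) = 1 / ((p : ℝ) - 1) := by
    simp only [pow_succ]
    rw [tsum_mul_right, tsum_geometric_of_lt_one (by positivity)
      (inv_lt_one_of_one_lt₀ (by linarith))]
    field_simp
  have hA : ∑' k, a (k + 1) =
      (p : ℝ) / ((p : ℝ) - 1) * (1 / ((p : ℝ) - 1) - ∑' k, innerTerm p k) := by
    rw [ha_succ, tsum_mul_left, hgs.tsum_sub hi, hgeom]
  rw [hsg.tsum_eq_zero_add]
  simp only [hg]
  rw [hsa1.tsum_sub (hsa.mul_left _), tsum_mul_left, hsa.tsum_eq_zero_add, ha0, hA, eulerFactor]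
  have h3 : (p : ℝ) ^ 2 - p + 1 ≠ 0 := by nlinarith
  have e : (1 - (p : ℝ)⁻¹ ^ 6) / ((1 - (p : ℝ)⁻¹ ^ 2) * (1 - (p : ℝ)⁻¹ ^ 3)) =
      ((p : ℝ) ^ 2 - p + 1) / (p * (p - 1)) := by
    have h4 : (p : ℝ) ^ 2 - 1 ≠ 0 := by nlinarith
    have h5 : (p : ℝ) ^ 3 - 1 ≠ 0 := by nlinarith [sq_nonneg (p : ℝ)]
    field_simp
    ring
  rw [e, pow_zero, isMultiplicative_regCoeff.map_one]
  field_simp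
  ring

/-- The values of the Riemann zeta function at natural numbers as a real number. -/
noncomputable def zetaNat (k : ℕ) : ℝ := ∑' n : ℕ, invRpowHom k n

lemma summable_invRpowHom_natCast {k : ℕ} (hk : 1 < k) : Summable (invRpowHom k) :=
  Real.summable_nat_rpow_inv.2 (by exact_mod_cast hk)

lemma ofReal_zetaNat {k : ℕ} (hk : 1 < k) : (zetaNat k : ℂ) = riemannZeta k := by
  rw [zeta_nat_eq_tsum_of_gt_one hk, zetaNat, Complex.ofReal_tsum]
  simp [invRpowHom_apply]

lemma zetaNat_pos {k : ℕ} (hk : 1 < k) : 0 < zetaNat k :=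
  (summable_invRpowHom_natCast hk).tsum_pos
    (fun n => inv_nonneg.2 (Real.rpow_nonneg n.cast_nonneg _)) 1 (by simp)

lemma hasProd_zetaNat {k : ℕ} (hk : 1 < k) :
    HasProd (fun p : Nat.Primes => (1 - ((p : ℕ) : ℝ)⁻¹ ^ k)⁻¹) (zetaNat k) := by
  have h := EulerProduct.eulerProduct_completely_multiplicative_hasProd
    (f := { invRpowHom k with
      map_zero' := by simp [invRpowHom, show k ≠ 0 by omega] })
    (summable_invRpowHom_natCast hk).norm
  refine h.congr_fun fun p => ?_
  simp [invRpowHom]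

/-- The Euler product of `∑ g(n) / n` is divided termwise by that of `ζ(2) ζ(3) / ζ(6)`, which is
nonzero; convergence of the product comes with its value. -/
lemma hasProd_eulerFactor :
    HasProd (fun p : Nat.Primes => eulerFactor p)
      ((∑' n : ℕ, regCoeff n / n) / (zetaNat 2 * zetaNat 3 / zetaNat 6)) := by
  have hR := ((hasProd_zetaNat (k := 2) (by norm_num)).mul
    (hasProd_zetaNat (k := 3) (by norm_num))).div₀ (hasProd_zetaNat (k := 6) (by norm_num))
    (zetaNat_pos (by norm_num)).ne'
  have hG := EulerProduct.eulerProduct_hasProd (f := fun n : ℕ => regCoeff n / n)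
    (by simp [isMultiplicative_regCoeff.map_one])
    (fun {m n} h => by
      rw [isMultiplicative_regCoeff.map_mul_of_coprime h, Nat.cast_mul, mul_div_mul_comm])
    summable_regCoeff_div.norm (by simp)
  have hne : zetaNat 2 * zetaNat 3 / zetaNat 6 ≠ 0 :=
    (div_pos (mul_pos (zetaNat_pos (by norm_num)) (zetaNat_pos (by norm_num)))
      (zetaNat_pos (by norm_num))).ne'
  refine (hG.div₀ hR hne).congr_fun fun p => ?_
  have h1 : ((p : ℕ) : ℝ)⁻¹ < 1 := inv_lt_one_of_one_lt₀ (by exact_mod_cast p.2.one_lt)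
  have h0 : (0 : ℝ) ≤ ((p : ℕ) : ℝ)⁻¹ := by positivity
  have hpow (k : ℕ) (hk : k ≠ 0) : 1 - ((p : ℕ) : ℝ)⁻¹ ^ k ≠ 0 :=
    (sub_pos.2 (pow_lt_one₀ h0 h1 hk)).ne'
  have h2 := hpow 2 (by norm_num)
  have h3 := hpow 3 (by norm_num)
  have h6 := hpow 6 (by norm_num)
  rw [tsum_regCoeff_prime_pow_div p.2]
  generalize ((p : ℕ) : ℝ)⁻¹ = q at *
  field_simp

theorem theorem6 :
    (∀ p : Nat.Primes, Summable (fun k : ℕ => innerTerm p k)) ∧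
    Multipliable (fun p : Nat.Primes => eulerFactor p) ∧
    ∃ D E : ℝ,
      (D : ℂ) = riemannZeta 2 * riemannZeta 3 / riemannZeta 6 *
        ((∏' p : Nat.Primes, eulerFactor p : ℝ) : ℂ) ∧
      (fun x : ℝ => (∑ n ∈ Finset.Icc 1 ⌊x⌋₊, 1 / (regCount n : ℝ)) - (D * Real.log x + E))
        =O[atTop] (fun x : ℝ => Real.log x ^ 9 / x) := by
  refine ⟨fun p => summable_innerTerm p.2, hasProd_eulerFactor.multipliable,
    ∑' n : ℕ, regCoeff n / n, regConst, ?_, isBigO_sum_inv_regCount.trans ?_⟩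
  · have hz2 := ofReal_zetaNat (k := 2) (by norm_num)
    have hz3 := ofReal_zetaNat (k := 3) (by norm_num)
    have hz6 := ofReal_zetaNat (k := 6) (by norm_num)
    have h2 := (zetaNat_pos (k := 2) (by norm_num)).ne'
    have h3 := (zetaNat_pos (k := 3) (by norm_num)).ne'
    have h6 := (zetaNat_pos (k := 6) (by norm_num)).ne'
    rw [Nat.cast_ofNat] at hz2 hz3 hz6
    rw [← hz2, ← hz3, ← hz6, hasProd_eulerFactor.tprod_eq]
    norm_cast
    field_simp
  · refine IsBigO.of_bound 1 ?_
    filter_upwards [eventually_ge_atTop (Real.exp 1)] with x hx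
    have hx0 : 0 < x := (Real.exp_pos 1).trans_le hx
    have hl : 1 ≤ Real.log x := (Real.le_log_iff_exp_le hx0).2 hx
    rw [Real.norm_of_nonneg (by positivity), Real.norm_of_nonneg (by positivity), one_mul]
    gcongr
    exact le_self_pow₀ hl (by norm_num)
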